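/- Let $\mathcal{R}$ be a von Neumann algebra acting on a complex Hilbert space $\mathcal{H}$, let $\mathcal{P}(\mathcal{R})$ be the complete lattice of (orthogonal) projections in $\mathcal{R}$, let $\mathcal{R}_{sa}$ be the set of selfadjoint elements of $\mathcal{R}$, and let $\mathcal{E}(\mathcal{R}) = \{A \in \mathcal{R}_{sa} \mid 0 \le A \le I\}$ (usual operator order) be the effect algebra of $\mathcal{R}$. For $A \in \mathcal{R}_{sa}$ let $(E^A_\lambda)_{\lambda \in \mathbb{R}}$ be its spectral family, i.e. $E^A_\lambda = \chi_{(-\infty,\lambda]}(A)$; this is the increasing, right-continuous family in $\mathcal{P}(\mathcal{R})$, equal to $0$ for $\lambda < -\|A\|$ and to $I$ for $\lambda \ge \|A\|$, with $A = \int_{\mathbb{R}} \lambda \, dE^A_\lambda$. The spectral order on $\mathcal{R}_{sa}$ is the partial order defined by: $A \le_s B$ if and only if $E^B_\lambda \le E^A_\lambda$ for all $\lambda \in \mathbb{R}$. Then $(\mathcal{R}_{sa}, \le_s)$ is a boundedly complete lattice, and (equivalently) $(\mathcal{E}(\mathcal{R}), \le_s)$ is a complete lattice. In detail: 1. Any two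 elements of $\mathcal{R}_{sa}$ have a supremum and an infimum in $(\mathcal{R}_{sa}, \le_s)$. 2. Let $(A_\kappa)_{\kappa \in \mathbb{K}}$ be a nonempty family in $\mathcal{R}_{sa}$. If it is bounded above with respect to $\le_s$, it has a supremum in $(\mathcal{R}_{sa}, \le_s)$, whose spectral family is $$E^{\vee}_\lambda = \bigwedge_{\kappa \in \mathbb{K}} E^{A_\kappa}_\lambda \qquad (\lambda \in \mathbb{R}).$$ If it is bounded below with respect to $\le_s$, it has an infimum in $(\mathcal{R}_{sa}, \le_s)$, whose spectral family is $$E^{\wedge}_\lambda = \bigwedge_{\mu > \lambda} \bigvee_{\kappa \in \mathbb{K}} E^{A_\kappa}_\mu \qquad (\lambda \in \mathbb{R}).$$ 3. Every family $(A_\kappa)_{\kappa \in \mathbb{K}}$ in $\mathcal{E}(\mathcal{R})$, possibly empty, has a supremum and an infimum in $(\mathcal{E}(\mathcal{R}), \le_s)$. If $\mathbb{K} \ne \emptyset$, their spectral families are the families $E^{\vee}$ and $E^{\wedge}$ given by the formulas in 2. All lattice operations on projections are taken in $\mathcal{P}(\mathcal{R})$. -/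

import Mathlib

namespace VonNeumannAlgebra

section SpectralLattice

variable {H : Type*} [NormedAddCommGroup H] [InnerProductSpace ℂ H] [CompleteSpace H]

/-! ### The lattice of projections of a von Neumann algebra -/

/-- The set of (orthogonal) projections belonging to the von Neumann algebra `R`. -/
def Projections (R : VonNeumannAlgebra H) : Type _ :=
  {P : H →L[ℂ] H // P ∈ R ∧ IsStarProjection P}

/-- Projections are ordered by the usual (Loewner) order of operators, equivalently by inclusion
of their ranges. -/
noncomputable instance (R : VonNeumannAlgebra H) : PartialOrder (Projections R) :=
  Subtype.partialOrder _

theorem starProjection_mem (R : VonNeumannAlgebra H) (K : Submodule ℂ H)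
    [K.HasOrthogonalProjection] (h : ∀ T ∈ R.commutant, ∀ x ∈ K, T x ∈ K) :
    K.starProjection ∈ R := by
  rw [IsStarProjection.mem_iff isStarProjection_starProjection]
  intro y hy x hx
  simp only [Submodule.range_starProjection] at hx ⊢
  exact h y hy x hx

theorem apply_mem_range_of_mem_commutant {R : VonNeumannAlgebra H} (P : Projections R)
    {T : H →L[ℂ] H} (hT : T ∈ R.commutant) {x : H} (hx : x ∈ P.1.range) : T x ∈ P.1.range :=
  (IsStarProjection.mem_iff P.2.2 R).1 P.2.1 T hT hx

theorem projections_le_iff {R : VonNeumannAlgebra H} (P Q : Projections R) :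
    P ≤ Q ↔ P.1.range ≤ Q.1.range := by
  obtain ⟨hp, hp'⟩ := isStarProjection_iff_eq_starProjection_range.1 P.2.2
  obtain ⟨hq, hq'⟩ := isStarProjection_iff_eq_starProjection_range.1 Q.2.2
  change P.1 ≤ Q.1 ↔ _
  conv_lhs => rw [hp', hq']
  exact Submodule.starProjection_le_starProjection_iff

theorem isClosed_range_projection {R : VonNeumannAlgebra H} (P : Projections R) :
    IsClosed (P.1.range : Set H) :=
  ContinuousLinearMap.IsIdempotentElem.isClosed_range P.2.2.isIdempotentElem

/-- The intersection of the ranges of a set of projections. -/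
def rangeInter {R : VonNeumannAlgebra H} (S : Set (Projections R)) : Submodule ℂ H :=
  ⨅ P ∈ S, P.1.range

theorem mem_rangeInter {R : VonNeumannAlgebra H} {S : Set (Projections R)} {x : H} :
    x ∈ rangeInter S ↔ ∀ P ∈ S, x ∈ P.1.range := by
  simp only [rangeInter, Submodule.mem_iInf]

instance {R : VonNeumannAlgebra H} (S : Set (Projections R)) :
    (rangeInter S).HasOrthogonalProjection := by
  have : IsClosed (rangeInter S : Set H) := by
    have h : (rangeInter S : Set H) = ⋂ P ∈ S, (P.1.range : Set H) := by
      ext x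
      simp only [SetLike.mem_coe, mem_rangeInter, Set.mem_iInter]
    rw [h]
    exact isClosed_biInter fun P _ => isClosed_range_projection P
  have : CompleteSpace (rangeInter S) := this.completeSpace_coe
  infer_instance

/-- The infimum of a set of projections of `R` is the projection onto the intersection of the
ranges. -/
noncomputable instance (R : VonNeumannAlgebra H) : InfSet (Projections R) where
  sInf S := ⟨(rangeInter S).starProjection,
    starProjection_mem R _ fun _ hT _ hx => mem_rangeInter.2 fun P hP =>
      apply_mem_range_of_mem_commutant P hT (mem_rangeInter.1 hx P hP),
    isStarProjection_starProjection⟩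

theorem range_sInf {R : VonNeumannAlgebra H} (S : Set (Projections R)) :
    (sInf S).1.range = rangeInter S :=
  Submodule.range_starProjection _

/-- The projections of `R` form a complete lattice. -/
noncomputable instance (R : VonNeumannAlgebra H) : CompleteLattice (Projections R) :=
  completeLatticeOfInf _ fun S => by
    refine ⟨fun P hP => ?_, fun Q hQ => ?_⟩
    · rw [projections_le_iff, range_sInf]
      exact fun x hx => mem_rangeInter.1 hx P hP
    · rw [projections_le_iff, range_sInf]
      exact fun x hx => mem_rangeInter.2 fun P hP => (projections_le_iff _ _).1 (hQ hP) hx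

/-! ### Selfadjoint elements and their spectral families -/

/-- The set `R_sa` of selfadjoint elements of `R`. It carries the spectral order defined below,
not the usual order of operators. -/
def SelfAdjointPart (R : VonNeumannAlgebra H) : Type _ :=
  {A : H →L[ℂ] H // A ∈ R ∧ IsSelfAdjoint A}

/-- The positive part `(A - l)⁺` of `A - l`, by continuous functional calculus. -/
noncomputable def posPartSub (A : H →L[ℂ] H) (l : ℝ) : H →L[ℂ] H :=
  cfc (fun t : ℝ => max (t - l) 0) A

/-- The spectral projection `E_l = χ_{(-∞, l]}(A)` of a selfadjoint operator `A` : the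
orthogonal projection onto the kernel of `(A - l)⁺`. -/
noncomputable def spectralProjection (A : H →L[ℂ] H) (l : ℝ) : H →L[ℂ] H :=
  (posPartSub A l).ker.starProjection

theorem spectralProjection_mem {R : VonNeumannAlgebra H} {A : H →L[ℂ] H} (hA : A ∈ R) (l : ℝ) :
    spectralProjection A l ∈ R := by
  refine starProjection_mem R _ fun T hT x hx => ?_
  have h : Commute (posPartSub A l) T :=
    Commute.cfc_real (mem_commutant_iff.1 hT A hA) _
  have h2 : posPartSub A l (T x) = T (posPartSub A l x) := congr($(h.eq) x)
  have hx' : posPartSub A l x = 0 := hx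
  change posPartSub A l (T x) = 0
  rw [h2, hx', map_zero]

/-- The spectral family `(E^A_l)`, `l` real, of `A ∈ R_sa`, as a family of projections of `R`. -/
noncomputable def spectralFamily {R : VonNeumannAlgebra H} (A : SelfAdjointPart R) (l : ℝ) :
    Projections R :=
  ⟨spectralProjection A.1 l, spectralProjection_mem A.2.1 l, isStarProjection_starProjection⟩

/-- A (bounded) spectral family in `R`: an increasing family of projections, continuous from the
right, which is `0` far to the left and the identity far to the right. -/
structure IsSpectralFamily {R : VonNeumannAlgebra H} (E : ℝ → Projections R) : Prop where
  mono : Monotone E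
  right_continuous : ∀ l : ℝ, ⨅ m : ℝ, ⨅ _ : l < m, E m = E l
  exists_eq_zero : ∃ a : ℝ, (E a).1 = 0
  exists_eq_one : ∃ b : ℝ, (E b).1 = 1

/-- `E` is a spectral family with `A = ∫ l dE_l`, as a norm limit of Riemann-Stieltjes sums. -/
structure IsSpectralFamilyOf {R : VonNeumannAlgebra H} (E : ℝ → Projections R)
    (A : H →L[ℂ] H) : Prop extends IsSpectralFamily E where
  integral : ∀ ε > 0, ∃ δ > 0, ∀ (n : ℕ) (p t : ℕ → ℝ),
    (E (p 0)).1 = 0 → (E (p n)).1 = 1 →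
    (∀ k < n, p k ≤ t k ∧ t k ≤ p (k + 1) ∧ p (k + 1) - p k ≤ δ) →
    ‖A - ∑ k ∈ Finset.range n, t k • ((E (p (k + 1))).1 - (E (p k)).1)‖ ≤ ε

/-! The next facts show that `spectralFamily A` is the spectral family of `A` in this sense. -/

/-- The negative part `(A - l)⁻` of `A - l`. -/
noncomputable def negPartSub (A : H →L[ℂ] H) (l : ℝ) : H →L[ℂ] H :=
  cfc (fun t : ℝ => max (l - t) 0) A

theorem isStarProjection_spectralProjection (A : H →L[ℂ] H) (l : ℝ) :
    IsStarProjection (spectralProjection A l) :=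
  isStarProjection_starProjection

theorem negPartSub_nonneg (A : H →L[ℂ] H) (l : ℝ) : 0 ≤ negPartSub A l :=
  cfc_nonneg fun _ _ => le_max_right _ _

theorem posPartSub_nonneg (A : H →L[ℂ] H) (l : ℝ) : 0 ≤ posPartSub A l :=
  cfc_nonneg fun _ _ => le_max_right _ _

theorem posPartSub_mul_negPartSub (A : H →L[ℂ] H) (l : ℝ) :
    posPartSub A l * negPartSub A l = 0 := by
  rw [posPartSub, negPartSub, ← cfc_mul _ _ _ (by fun_prop) (by fun_prop)]
  rw [← cfc_zero ℝ A]
  congr 1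
  ext t
  rcases le_total t l with h | h
  · simp [max_eq_right (sub_nonpos.2 h)]
  · simp [max_eq_right (sub_nonpos.2 h)]

theorem sub_eq_posPartSub_sub_negPartSub {A : H →L[ℂ] H} (hA : IsSelfAdjoint A) (l : ℝ) :
    A - l • (1 : H →L[ℂ] H) = posPartSub A l - negPartSub A l := by
  rw [posPartSub, negPartSub, ← cfc_sub _ _ _ (by fun_prop) (by fun_prop)]
  have : (fun t : ℝ => max (t - l) 0 - max (l - t) 0) = fun t => t - l := by
    ext t
    rcases le_total t l with h | h
    · rw [max_eq_right (sub_nonpos.2 h), max_eq_left (sub_nonneg.2 h)]; ring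
    · rw [max_eq_right (sub_nonpos.2 h), max_eq_left (sub_nonneg.2 h)]; ring
  rw [this, cfc_sub (fun t => t) (fun _ => l) A (by fun_prop) (by fun_prop), cfc_id' ℝ A,
    cfc_const l A, Algebra.algebraMap_eq_smul_one]

theorem posPartSub_mul_spectralProjection (A : H →L[ℂ] H) (l : ℝ) :
    posPartSub A l * spectralProjection A l = 0 := by
  ext x
  exact ((posPartSub A l).ker.starProjection_apply_mem x :)

theorem spectralProjection_mul_of_posPartSub_mul {A T : H →L[ℂ] H} {l : ℝ}
    (h : posPartSub A l * T = 0) : spectralProjection A l * T = T := by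
  ext x
  exact Submodule.starProjection_eq_self_iff.2 (congr($h x) :)

theorem spectralProjection_mul_negPartSub (A : H →L[ℂ] H) (l : ℝ) :
    spectralProjection A l * negPartSub A l = negPartSub A l :=
  spectralProjection_mul_of_posPartSub_mul (posPartSub_mul_negPartSub A l)

theorem negPartSub_mul_spectralProjection (A : H →L[ℂ] H) (l : ℝ) :
    negPartSub A l * spectralProjection A l = negPartSub A l := by
  have := congr(star $(spectralProjection_mul_negPartSub A l))
  rwa [star_mul, (IsSelfAdjoint.of_nonneg (negPartSub_nonneg A l)).star_eq,
    (isStarProjection_spectralProjection A l).isSelfAdjoint.star_eq] at this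

theorem spectralProjection_mul_posPartSub (A : H →L[ℂ] H) (l : ℝ) :
    spectralProjection A l * posPartSub A l = 0 := by
  have := congr(star $(posPartSub_mul_spectralProjection A l))
  rwa [star_mul, (IsSelfAdjoint.of_nonneg (posPartSub_nonneg A l)).star_eq,
    (isStarProjection_spectralProjection A l).isSelfAdjoint.star_eq, star_zero] at this

theorem sub_mul_spectralProjection {A : H →L[ℂ] H} (hA : IsSelfAdjoint A) (l : ℝ) :
    (A - l • (1 : H →L[ℂ] H)) * spectralProjection A l = -negPartSub A l := by
  rw [sub_eq_posPartSub_sub_negPartSub hA, sub_mul, posPartSub_mul_spectralProjection,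
    negPartSub_mul_spectralProjection, zero_sub]

theorem spectralProjection_mul_sub {A : H →L[ℂ] H} (hA : IsSelfAdjoint A) (l : ℝ) :
    spectralProjection A l * (A - l • (1 : H →L[ℂ] H)) = -negPartSub A l := by
  rw [sub_eq_posPartSub_sub_negPartSub hA, mul_sub, spectralProjection_mul_posPartSub,
    spectralProjection_mul_negPartSub, zero_sub]

theorem commute_spectralProjection {A : H →L[ℂ] H} (hA : IsSelfAdjoint A) (l : ℝ) :
    Commute A (spectralProjection A l) := by
  have h := (sub_mul_spectralProjection hA l).trans (spectralProjection_mul_sub hA l).symm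
  rw [sub_mul, mul_sub, smul_mul_assoc, mul_smul_comm, one_mul, mul_one] at h
  exact sub_left_injective h

theorem spectralProjection_mul_of_le (A : H →L[ℂ] H) {l m : ℝ} (h : l ≤ m) :
    spectralProjection A m * spectralProjection A l = spectralProjection A l := by
  rcases h.eq_or_lt with rfl | h
  · exact (isStarProjection_spectralProjection A l).isIdempotentElem
  apply spectralProjection_mul_of_posPartSub_mul
  have hc : ∀ t : ℝ, max (t - l) (m - l) ≠ 0 := fun t =>
    (lt_of_lt_of_le (sub_pos.2 h) (le_max_right _ _)).ne'
  have : posPartSub A m =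
      cfc (fun t : ℝ => max (t - m) 0 / max (t - l) (m - l)) A * posPartSub A l := by
    have hcont : Continuous fun t : ℝ => max (t - m) 0 / max (t - l) (m - l) :=
      Continuous.div (by fun_prop) (by fun_prop) hc
    rw [posPartSub, posPartSub, ← cfc_mul _ _ _ hcont.continuousOn (by fun_prop)]
    congr 1
    ext t
    rcases le_total t m with h1 | h1
    · simp [max_eq_right (sub_nonpos.2 h1)]
    · have h2 : m - l ≤ t - l := by linarith
      have h3 : 0 < t - l := by linarith
      rw [max_eq_left h2, max_eq_left h3.le, div_mul_cancel₀ _ h3.ne']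
  rw [this, mul_assoc, posPartSub_mul_spectralProjection, mul_zero]

theorem spectralFamily_mono {R : VonNeumannAlgebra H} (A : SelfAdjointPart R) :
    Monotone (spectralFamily A) := fun l m h =>
  (IsStarProjection.le_iff_mul_eq_right (isStarProjection_spectralProjection A.1 l)
    (isStarProjection_spectralProjection A.1 m)).2 (spectralProjection_mul_of_le A.1 h)

theorem range_spectralFamily {R : VonNeumannAlgebra H} (A : SelfAdjointPart R) (l : ℝ) :
    (spectralFamily A l).1.range = (posPartSub A.1 l).ker :=
  Submodule.range_starProjection _

theorem norm_posPartSub_sub_le (A : H →L[ℂ] H) {l m : ℝ} (h : l ≤ m) :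
    ‖posPartSub A l - posPartSub A m‖ ≤ m - l := by
  rw [posPartSub, posPartSub, ← cfc_sub _ _ _ (by fun_prop) (by fun_prop)]
  refine norm_cfc_le (sub_nonneg.2 h) fun t _ => ?_
  rw [Real.norm_eq_abs, abs_le]
  rcases max_cases (t - l) 0 with h1 | h1 <;> rcases max_cases (t - m) 0 with h2 | h2 <;>
    constructor <;> linarith

theorem spectralFamily_right_continuous {R : VonNeumannAlgebra H} (A : SelfAdjointPart R)
    (l : ℝ) : ⨅ m : ℝ, ⨅ _ : l < m, spectralFamily A m = spectralFamily A l := by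
  refine le_antisymm ?_ (le_iInf₂ fun m hm => spectralFamily_mono A hm.le)
  rw [projections_le_iff, range_spectralFamily]
  intro x hx
  have hx' : ∀ m, l < m → posPartSub A.1 m x = 0 := fun m hm => by
    have := (projections_le_iff _ _).1 (iInf₂_le (f := fun m (_ : l < m) => spectralFamily A m)
      m hm) hx
    rwa [range_spectralFamily] at this
  change posPartSub A.1 l x = 0
  have hb : ∀ m, l < m → ‖posPartSub A.1 l x‖ ≤ (m - l) * ‖x‖ := fun m hm => by
    have h1 : posPartSub A.1 l x = (posPartSub A.1 l - posPartSub A.1 m) x := by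
      rw [sub_apply, hx' m hm, sub_zero]
    rw [h1]
    exact ((posPartSub A.1 l - posPartSub A.1 m).le_opNorm x).trans
      (mul_le_mul_of_nonneg_right (norm_posPartSub_sub_le A.1 hm.le) (norm_nonneg x))
  rw [← norm_le_zero_iff]
  refine ge_of_tendsto (x := nhdsWithin l (Set.Ioi l)) (f := fun m => (m - l) * ‖x‖) ?_
    (Filter.eventually_of_mem self_mem_nhdsWithin hb)
  have : Filter.Tendsto (fun m => (m - l) * ‖x‖) (nhds l) (nhds ((l - l) * ‖x‖)) :=
    Continuous.tendsto (by fun_prop) l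
  rw [sub_self, zero_mul] at this
  exact this.mono_left nhdsWithin_le_nhds

theorem eq_zero_of_smul_nonpos {P : H →L[ℂ] H} (hP : IsStarProjection P) {c : ℝ}
    (hc : 0 < c) (h : c • P ≤ 0) : P = 0 := by
  refine le_antisymm ?_ hP.nonneg
  have := smul_le_smul_of_nonneg_left h (inv_pos.2 hc).le
  rwa [smul_smul, inv_mul_cancel₀ hc.ne', one_smul, smul_zero] at this

theorem spectralProjection_eq_zero {A : H →L[ℂ] H} (hA : IsSelfAdjoint A) {l : ℝ}
    (hl : l < -‖A‖) : spectralProjection A l = 0 := by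
  have hP := isStarProjection_spectralProjection A l
  refine eq_zero_of_smul_nonpos hP (c := -‖A‖ - l) (by linarith) ?_
  have h1 : A * spectralProjection A l ≤ l • spectralProjection A l := by
    have h := sub_mul_spectralProjection hA l
    rw [sub_mul, smul_mul_assoc, one_mul] at h
    rw [← sub_nonpos, h]
    exact neg_nonpos.2 (negPartSub_nonneg A l)
  have h2 := hP.isSelfAdjoint.conjugate_le_conjugate hA.neg_algebraMap_norm_le_self
  rw [Algebra.algebraMap_eq_smul_one, mul_assoc _ A, (commute_spectralProjection hA l).eq,
    ← mul_assoc, hP.isIdempotentElem.eq, mul_neg, neg_mul, mul_smul_comm, smul_mul_assoc, mul_one,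
    hP.isIdempotentElem.eq, ← (commute_spectralProjection hA l).eq] at h2
  rw [sub_smul, neg_smul]
  exact sub_nonpos.2 (h2.trans h1)

theorem spectralProjection_eq_one {A : H →L[ℂ] H} (hA : IsSelfAdjoint A) {l : ℝ}
    (hl : ‖A‖ ≤ l) : spectralProjection A l = 1 := by
  have h0 : posPartSub A l = 0 := by
    rw [posPartSub, ← cfc_zero ℝ A]
    refine cfc_congr fun t ht => ?_
    have h2 : t ≤ ‖A‖ := (le_algebraMap_iff_spectrum_le (R := ℝ)).1 hA.le_algebraMap_norm_self t ht
    exact max_eq_right (by linarith)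
  have := spectralProjection_mul_of_posPartSub_mul (A := A) (T := 1) (l := l) (by rw [h0, zero_mul])
  rwa [mul_one] at this

theorem spectralProjection_sub_bounds {A : H →L[ℂ] H} (hA : IsSelfAdjoint A) {l m : ℝ}
    (h : l ≤ m) :
    l • (spectralProjection A m - spectralProjection A l) ≤
        A * (spectralProjection A m - spectralProjection A l) ∧
      A * (spectralProjection A m - spectralProjection A l) ≤
        m • (spectralProjection A m - spectralProjection A l) := by
  have hl := isStarProjection_spectralProjection A l
  have hm := isStarProjection_spectralProjection A m
  have hml := spectralProjection_mul_of_le A h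
  have hlm : spectralProjection A l * spectralProjection A m = spectralProjection A l := by
    have := congr(star $hml)
    rwa [star_mul, hl.isSelfAdjoint.star_eq, hm.isSelfAdjoint.star_eq] at this
  have hD : IsStarProjection (spectralProjection A m - spectralProjection A l) :=
    (hl.le_iff_sub hm).1 ((hl.le_iff_mul_eq_right hm).2 hml)
  have hc : Commute A (spectralProjection A m - spectralProjection A l) :=
    (commute_spectralProjection hA m).sub_right (commute_spectralProjection hA l)
  have hmD : spectralProjection A m * (spectralProjection A m - spectralProjection A l) =
      spectralProjection A m - spectralProjection A l := by
    rw [mul_sub, hm.isIdempotentElem.eq, hml]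
  have hlD : spectralProjection A l * (spectralProjection A m - spectralProjection A l) = 0 := by
    rw [mul_sub, hl.isIdempotentElem.eq, hlm, sub_self]
  set D := spectralProjection A m - spectralProjection A l
  have hconj : ∀ B : H →L[ℂ] H, Commute B D → D * B * D = B * D := fun B hB => by
    rw [← hB.eq, mul_assoc, hD.isIdempotentElem.eq]
  have hcl : Commute (A - l • (1 : H →L[ℂ] H)) D :=
    hc.sub_left ((Commute.one_left D).smul_left l)
  have hcm : Commute (A - m • (1 : H →L[ℂ] H)) D :=
    hc.sub_left ((Commute.one_left D).smul_left m)
  constructor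
  · have h1 : (A - l • (1 : H →L[ℂ] H)) * D = posPartSub A l * D := by
      rw [sub_eq_posPartSub_sub_negPartSub hA, sub_mul, ← negPartSub_mul_spectralProjection,
        mul_assoc (negPartSub A l), hlD, mul_zero, sub_zero]
    have h2 : D * posPartSub A l * D = A * D - l • D := by
      rw [mul_assoc, ← h1, ← mul_assoc, hconj _ hcl, sub_mul, smul_mul_assoc, one_mul]
    rw [← sub_nonneg, ← h2]
    exact hD.isSelfAdjoint.conjugate_nonneg (posPartSub_nonneg A l)
  · have h1 : (A - m • (1 : H →L[ℂ] H)) * D = -(negPartSub A m * D) := by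
      rw [← hmD, ← mul_assoc, sub_mul_spectralProjection hA, neg_mul, hmD]
    have h2 : D * negPartSub A m * D = m • D - A * D := by
      have h3 : negPartSub A m * D = -((A - m • (1 : H →L[ℂ] H)) * D) := by rw [h1, neg_neg]
      rw [mul_assoc, h3, mul_neg, ← mul_assoc, hconj _ hcm, sub_mul, smul_mul_assoc, one_mul,
        neg_sub]
    rw [← sub_nonneg, ← h2]
    exact hD.isSelfAdjoint.conjugate_nonneg (negPartSub_nonneg A m)

theorem norm_le_of_neg_le_of_le {S : H →L[ℂ] H} (hS : IsSelfAdjoint S) {δ : ℝ} (hδ : 0 ≤ δ)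
    (h1 : -(δ • (1 : H →L[ℂ] H)) ≤ S) (h2 : S ≤ δ • (1 : H →L[ℂ] H)) : ‖S‖ ≤ δ := by
  rw [← neg_smul] at h1
  rw [← Algebra.algebraMap_eq_smul_one] at h1 h2
  rw [← cfc_id ℝ S]
  refine norm_cfc_le hδ fun t ht => abs_le.2
    ⟨(algebraMap_le_iff_le_spectrum (R := ℝ)).1 h1 t ht,
      (le_algebraMap_iff_spectrum_le (R := ℝ)).1 h2 t ht⟩

theorem norm_sub_sum_le {A : H →L[ℂ] H} (hA : IsSelfAdjoint A) {δ : ℝ} (hδ : 0 ≤ δ) (n : ℕ)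
    (p t : ℕ → ℝ) (h0 : spectralProjection A (p 0) = 0) (hn : spectralProjection A (p n) = 1)
    (h : ∀ k < n, p k ≤ t k ∧ t k ≤ p (k + 1) ∧ p (k + 1) - p k ≤ δ) :
    ‖A - ∑ k ∈ Finset.range n,
      t k • (spectralProjection A (p (k + 1)) - spectralProjection A (p k))‖ ≤ δ := by
  have hone : ∑ k ∈ Finset.range n,
      (spectralProjection A (p (k + 1)) - spectralProjection A (p k)) = 1 := by
    rw [Finset.sum_range_sub (fun k => spectralProjection A (p k)), h0, hn, sub_zero]
  have hS : A - ∑ k ∈ Finset.range n,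
      t k • (spectralProjection A (p (k + 1)) - spectralProjection A (p k)) =
      ∑ k ∈ Finset.range n,
        (A * (spectralProjection A (p (k + 1)) - spectralProjection A (p k)) -
          t k • (spectralProjection A (p (k + 1)) - spectralProjection A (p k))) := by
    rw [Finset.sum_sub_distrib, ← Finset.mul_sum, hone, mul_one]
  have hD : ∀ k < n, 0 ≤ spectralProjection A (p (k + 1)) - spectralProjection A (p k) :=
    fun k hk => sub_nonneg.2
      (((isStarProjection_spectralProjection A _).le_iff_mul_eq_right
        (isStarProjection_spectralProjection A _)).2
        (spectralProjection_mul_of_le A ((h k hk).1.trans (h k hk).2.1)))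
  refine norm_le_of_neg_le_of_le ?_ hδ ?_ ?_
  · refine hA.sub (isSelfAdjoint_sum _ fun k _ => ?_)
    exact (IsSelfAdjoint.all (t k)).smul
      ((isStarProjection_spectralProjection A (p (k + 1))).isSelfAdjoint.sub
        (isStarProjection_spectralProjection A (p k)).isSelfAdjoint)
  · rw [hS, ← hone, Finset.smul_sum, ← Finset.sum_neg_distrib]
    refine Finset.sum_le_sum fun k hk => ?_
    have hk := Finset.mem_range.1 hk
    obtain ⟨a1, a2, a3⟩ := h k hk
    have hb := (spectralProjection_sub_bounds hA (a1.trans a2)).1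
    refine le_trans ?_ (sub_le_sub_right hb _)
    rw [← neg_smul, ← sub_smul]
    exact smul_le_smul_of_nonneg_right (by linarith) (hD k hk)
  · rw [hS, ← hone, Finset.smul_sum]
    refine Finset.sum_le_sum fun k hk => ?_
    have hk := Finset.mem_range.1 hk
    obtain ⟨a1, a2, a3⟩ := h k hk
    have hb := (spectralProjection_sub_bounds hA (a1.trans a2)).2
    refine le_trans (sub_le_sub_right hb _) ?_
    rw [← sub_smul]
    exact smul_le_smul_of_nonneg_right (by linarith) (hD k hk)

/-- `spectralFamily A` is a spectral family, and `A` is its integral. -/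
theorem isSpectralFamilyOf_spectralFamily {R : VonNeumannAlgebra H} (A : SelfAdjointPart R) :
    IsSpectralFamilyOf (spectralFamily A) A.1 where
  mono := spectralFamily_mono A
  right_continuous := spectralFamily_right_continuous A
  exists_eq_zero := ⟨-‖A.1‖ - 1, spectralProjection_eq_zero A.2.2 (by linarith)⟩
  exists_eq_one := ⟨‖A.1‖, spectralProjection_eq_one A.2.2 le_rfl⟩
  integral ε hε := ⟨ε, hε, fun n p t h0 hn h => norm_sub_sum_le A.2.2 hε.le n p t h0 hn h⟩

theorem spectralFamily_injective {R : VonNeumannAlgebra H} {A B : SelfAdjointPart R}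
    (h : spectralFamily A = spectralFamily B) : A = B := by
  have hE := fun l => congrArg Subtype.val (congrFun h l)
  apply Subtype.ext
  rw [← sub_eq_zero, ← norm_le_zero_iff]
  refine le_of_forall_pos_le_add fun ε hε => ?_
  set c := max ‖A.1‖ ‖B.1‖ + 1 with hc
  have hcA : ‖A.1‖ < c := (le_max_left _ _).trans_lt (lt_add_one _)
  have hcB : ‖B.1‖ < c := (le_max_right _ _).trans_lt (lt_add_one _)
  have hc0 : 0 < c := (norm_nonneg _).trans_lt hcA
  obtain ⟨n, hn⟩ := exists_nat_gt (2 * c / (ε / 2))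
  have hn0 : (0 : ℝ) < n := lt_of_le_of_lt (by positivity) hn
  have hd : 2 * c / n ≤ ε / 2 := by
    rw [div_lt_iff₀ (by positivity)] at hn
    rw [div_le_iff₀ hn0]
    linarith
  let p : ℕ → ℝ := fun k => -c + k * (2 * c / n)
  have hp0 : p 0 = -c := by simp [p]
  have hpn : p n = c := by
    simp only [p]
    field_simp
    ring
  have hp : ∀ k < n, p k ≤ p k ∧ p k ≤ p (k + 1) ∧ p (k + 1) - p k ≤ ε / 2 := fun k _ => by
    have h1 : p (k + 1) - p k = 2 * c / n := by simp only [p]; push_cast; ring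
    have h2 : 0 ≤ 2 * c / n := by positivity
    exact ⟨le_rfl, by linarith, by linarith⟩
  have hA := norm_sub_sum_le A.2.2 (half_pos hε).le n p p
    (hp0 ▸ spectralProjection_eq_zero A.2.2 (by linarith))
    (hpn ▸ spectralProjection_eq_one A.2.2 hcA.le) hp
  have hB := norm_sub_sum_le B.2.2 (half_pos hε).le n p p
    (hp0 ▸ spectralProjection_eq_zero B.2.2 (by linarith))
    (hpn ▸ spectralProjection_eq_one B.2.2 hcB.le) hp
  have hs : ∀ l, spectralProjection A.1 l = spectralProjection B.1 l := hE
  simp only [hs] at hA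
  rw [norm_sub_rev] at hB
  calc ‖A.1 - B.1‖ ≤ _ := norm_sub_le_norm_sub_add_norm_sub _ _ _
    _ ≤ ε / 2 + ε / 2 := add_le_add hA hB
    _ = 0 + ε := by ring

/-! ### The spectral order -/

/-- The spectral order on `R_sa`: `A ≤ B` if and only if `E^B_l ≤ E^A_l` for all real `l`. -/
noncomputable instance (R : VonNeumannAlgebra H) : PartialOrder (SelfAdjointPart R) where
  le A B := ∀ l : ℝ, spectralFamily B l ≤ spectralFamily A l
  le_refl _ _ := le_rfl
  le_trans _ _ _ h₁ h₂ l := (h₂ l).trans (h₁ l)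
  le_antisymm _ _ h₁ h₂ := spectralFamily_injective (funext fun l => le_antisymm (h₂ l) (h₁ l))

/-- The effect algebra of `R`: the `A ∈ R_sa` with `0 ≤ A ≤ I` in the usual (Loewner) order of
operators. As a subset of `R_sa` it carries the spectral order. -/
abbrev EffectAlgebra (R : VonNeumannAlgebra H) : Type _ :=
  {A : SelfAdjointPart R // 0 ≤ A.1 ∧ A.1 ≤ 1}

end SpectralLattice

end VonNeumannAlgebra

/-!
The assignment `A ↦ E^A` reverses order by definition of the spectral order, and it is injective.
The lattice operations on selfadjoint operators therefore reduce to lattice operations on spectral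
families, provided that every bounded spectral family in `R` is the spectral family of some
selfadjoint element of `R`.

This converse of the spectral theorem is `IsSpectralFamily.exists_spectralFamily_eq`. The operator
`A = ∫ l dE_l` is the norm limit of lower Riemann-Stieltjes sums over dyadic partitions: halving
every interval changes the sum by at most half the mesh (`norm_dyadicSum_succ_sub_le`). Each sum
commutes with the commutant of `R`, hence so does the limit, which thus lies in `R`. Multiplying
the sums by `E_l` and by `1 - E_l` and passing to the limit gives `A E_l ≤ l E_l` and
`l (1 - E_l) ≤ A (1 - E_l)`. By uniqueness of positive and negative parts, `(A - l) (1 - E_l)` is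
the positive part of `A - l`, and right continuity of `E` identifies its kernel with the range of
`E_l` (`IsSpectralFamily.spectralFamily_eq`).

It remains to see that the two formulas define spectral families. Each must be
the zero projection far to the left and the identity far to the right: a bound of the `A_k` for the
spectral order gives one of these, and any single `A_k` gives the other (`isSpectralFamily_iInf`,
`isSpectralFamily_iInf_iSup`). Two elements are always bounded, by
scalars. Finally `0 ≤ A ≤ 1` holds in the usual order if and only if it holds in the spectral order
(`effect_iff_spectralOrder`), so effects form an order interval and are closed under suprema and
infima of nonempty families.
-/

namespace VonNeumannAlgebra

open Filter Topology

section SpectralTheorem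

variable {H : Type*} [NormedAddCommGroup H] [InnerProductSpace ℂ H] [CompleteSpace H]
  {R : VonNeumannAlgebra H}

/-! ### The lattice of projections -/

theorem mem_range_iInf {ι : Sort*} (P : ι → Projections R) (x : H) :
    x ∈ (⨅ i, P i).1.range ↔ ∀ i, x ∈ (P i).1.range := by
  change x ∈ (sInf (Set.range P)).1.range ↔ _
  rw [range_sInf, mem_rangeInter, Set.forall_mem_range]

theorem mem_range_iff {P : H →L[ℂ] H} (hP : IsStarProjection P) {x : H} :
    x ∈ P.range ↔ P x = x :=
  ⟨by rintro ⟨y, rfl⟩; exact congr($hP.isIdempotentElem.eq y), fun h => ⟨x, h⟩⟩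

theorem coe_bot : (⊥ : Projections R).1 = 0 := by
  let Z : Projections R := ⟨0, zero_mem R, .zero _⟩
  have h : Z = ⊥ := bot_unique
    (show Z.1 ≤ (⊥ : Projections R).1 from (⊥ : Projections R).2.2.nonneg)
  rw [← h]

theorem coe_top : (⊤ : Projections R).1 = 1 := by
  let I : Projections R := ⟨1, one_mem R, .one _⟩
  have h : I = ⊤ := top_unique
    (show (⊤ : Projections R).1 ≤ I.1 from (⊤ : Projections R).2.2.le_one)
  rw [← h]

theorem coe_eq_zero_iff {P : Projections R} : P.1 = 0 ↔ P = ⊥ := by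
  rw [← coe_bot (R := R)]
  exact Subtype.val_inj

theorem coe_eq_one_iff {P : Projections R} : P.1 = 1 ↔ P = ⊤ := by
  rw [← coe_top (R := R)]
  exact Subtype.val_inj

theorem mul_of_projections_le {P Q : Projections R} (h : P ≤ Q) :
    P.1 * Q.1 = P.1 ∧ Q.1 * P.1 = P.1 :=
  ⟨(P.2.2.le_iff_mul_eq_left Q.2.2).1 h, (P.2.2.le_iff_mul_eq_right Q.2.2).1 h⟩

theorem commute_of_monotone {E : ℝ → Projections R} (hE : Monotone E) (l m : ℝ) :
    Commute (E l).1 (E m).1 := by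
  rcases le_total l m with h | h
  · exact (mul_of_projections_le (hE h)).1.trans (mul_of_projections_le (hE h)).2.symm
  · exact (mul_of_projections_le (hE h)).2.trans (mul_of_projections_le (hE h)).1.symm

theorem isStarProjection_sub_of_monotone {E : ℝ → Projections R} (hE : Monotone E) {l m : ℝ}
    (h : l ≤ m) : IsStarProjection ((E m).1 - (E l).1) :=
  ((E l).2.2.le_iff_sub (E m).2.2).1 (hE h)

theorem commute_sub_of_monotone {E : ℝ → Projections R} (hE : Monotone E) (l m k : ℝ) :
    Commute ((E m).1 - (E l).1) (E k).1 :=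
  (commute_of_monotone hE m k).sub_left (commute_of_monotone hE l k)

/-! ### Dyadic Riemann sums of a spectral family -/

/-- The `k`-th point of the partition of `[a, b]` into `2 ^ n` equal parts. -/
noncomputable def dyadicPoint (a b : ℝ) (n k : ℕ) : ℝ := a + k * ((b - a) / 2 ^ n)

/-- The lower Riemann-Stieltjes sum of `∫ l dE_l` for the partition of `[a, b]` into `2 ^ n`
equal parts. -/
noncomputable def dyadicSum (E : ℝ → Projections R) (a b : ℝ) (n : ℕ) : H →L[ℂ] H :=
  ∑ k ∈ Finset.range (2 ^ n), dyadicPoint a b n k •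
    ((E (dyadicPoint a b n (k + 1))).1 - (E (dyadicPoint a b n k)).1)

theorem dyadicPoint_zero (a b : ℝ) (n : ℕ) : dyadicPoint a b n 0 = a := by
  simp [dyadicPoint]

theorem dyadicPoint_last (a b : ℝ) (n : ℕ) : dyadicPoint a b n (2 ^ n) = b := by
  simp only [dyadicPoint, Nat.cast_pow, Nat.cast_ofNat]
  field_simp
  ring

theorem dyadicPoint_succ (a b : ℝ) (n k : ℕ) :
    dyadicPoint a b n (k + 1) = dyadicPoint a b n k + (b - a) / 2 ^ n := by
  simp only [dyadicPoint, Nat.cast_add, Nat.cast_one]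
  ring

theorem dyadicPoint_mono {a b : ℝ} (hab : a ≤ b) (n k : ℕ) :
    dyadicPoint a b n k ≤ dyadicPoint a b n (k + 1) := by
  have : 0 ≤ (b - a) / 2 ^ n := div_nonneg (sub_nonneg.2 hab) (by positivity)
  rw [dyadicPoint_succ]
  linarith

theorem dyadicPoint_double (a b : ℝ) (n k : ℕ) :
    dyadicPoint a b (n + 1) (2 * k) = dyadicPoint a b n k := by
  simp only [dyadicPoint, Nat.cast_mul, Nat.cast_ofNat, pow_succ]
  field_simp

theorem sum_dyadic_sub {E : ℝ → Projections R} {a b : ℝ} (ha : (E a).1 = 0) (hb : (E b).1 = 1)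
    (n : ℕ) : ∑ k ∈ Finset.range (2 ^ n),
      ((E (dyadicPoint a b n (k + 1))).1 - (E (dyadicPoint a b n k)).1) = 1 := by
  rw [Finset.sum_range_sub (fun k => (E (dyadicPoint a b n k)).1), dyadicPoint_last,
    dyadicPoint_zero, ha, hb, sub_zero]

theorem sum_range_two_mul {M : Type*} [AddCommMonoid M] (f : ℕ → M) (N : ℕ) :
    ∑ k ∈ Finset.range (2 * N), f k = ∑ k ∈ Finset.range N, (f (2 * k) + f (2 * k + 1)) := by
  induction N with
  | zero => simp
  | succ N ih =>
    rw [Nat.mul_succ, Finset.sum_range_succ, Finset.sum_range_succ, ih, Finset.sum_range_succ,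
      add_assoc]

/-- Halving every interval raises the lower sum by half the mesh times a sum of spectral
projections of disjoint intervals. -/
theorem dyadicSum_succ_sub (E : ℝ → Projections R) (a b : ℝ) (n : ℕ) :
    dyadicSum E a b (n + 1) - dyadicSum E a b n = ((b - a) / 2 ^ (n + 1)) •
      ∑ k ∈ Finset.range (2 ^ n), ((E (dyadicPoint a b n (k + 1))).1 -
        (E (dyadicPoint a b (n + 1) (2 * k + 1))).1) := by
  rw [dyadicSum, dyadicSum, pow_succ', sum_range_two_mul, ← Finset.sum_sub_distrib,
    Finset.smul_sum]
  refine Finset.sum_congr rfl fun k _ => ?_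
  rw [show 2 * k + 1 + 1 = 2 * (k + 1) by ring, dyadicPoint_double, dyadicPoint_double,
    dyadicPoint_succ _ _ (n + 1) (2 * k), dyadicPoint_double, pow_succ']
  module

theorem norm_dyadicSum_succ_sub_le {E : ℝ → Projections R} (hE : Monotone E) {a b : ℝ}
    (hab : a ≤ b) (ha : (E a).1 = 0) (hb : (E b).1 = 1) (n : ℕ) :
    ‖dyadicSum E a b (n + 1) - dyadicSum E a b n‖ ≤ (b - a) / 2 ^ (n + 1) := by
  have hδ : 0 ≤ (b - a) / 2 ^ (n + 1) := div_nonneg (sub_nonneg.2 hab) (by positivity)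
  have h1 := fun k => dyadicPoint_mono hab (n + 1) (2 * k)
  have h2 : ∀ k, dyadicPoint a b (n + 1) (2 * k + 1) ≤ dyadicPoint a b n (k + 1) := fun k => by
    rw [← dyadicPoint_double a b n (k + 1)]
    exact dyadicPoint_mono hab (n + 1) (2 * k + 1)
  simp only [dyadicPoint_double] at h1
  have h0 : 0 ≤ ∑ k ∈ Finset.range (2 ^ n), ((E (dyadicPoint a b n (k + 1))).1 -
        (E (dyadicPoint a b (n + 1) (2 * k + 1))).1) :=
    Finset.sum_nonneg fun k _ => (isStarProjection_sub_of_monotone hE (h2 k)).nonneg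
  rw [dyadicSum_succ_sub]
  refine norm_le_of_neg_le_of_le ((IsSelfAdjoint.all _).smul (.of_nonneg h0)) hδ ?_ ?_
  · exact (neg_nonpos.2 (smul_nonneg hδ zero_le_one)).trans (smul_nonneg hδ h0)
  · refine smul_le_smul_of_nonneg_left ?_ hδ
    rw [← sum_dyadic_sub ha hb n]
    refine Finset.sum_le_sum fun k _ => sub_le_sub_left ?_ _
    exact hE (h1 k)

theorem cauchySeq_dyadicSum {E : ℝ → Projections R} (hE : Monotone E) {a b : ℝ}
    (hab : a ≤ b) (ha : (E a).1 = 0) (hb : (E b).1 = 1) : CauchySeq (dyadicSum E a b) := by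
  refine cauchySeq_of_le_geometric_two (C := b - a) fun n => ?_
  rw [dist_comm, dist_eq_norm]
  refine (norm_dyadicSum_succ_sub_le hE hab ha hb n).trans_eq ?_
  rw [pow_succ']
  field_simp

theorem isSelfAdjoint_dyadicSum (E : ℝ → Projections R) (a b : ℝ) (n : ℕ) :
    IsSelfAdjoint (dyadicSum E a b n) :=
  isSelfAdjoint_sum _ fun _ _ => (IsSelfAdjoint.all _).smul
    ((E _).2.2.isSelfAdjoint.sub (E _).2.2.isSelfAdjoint)

theorem commute_dyadicSum {E : ℝ → Projections R} {T : H →L[ℂ] H}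
    (hT : ∀ l, Commute (E l).1 T) (a b : ℝ) (n : ℕ) : Commute (dyadicSum E a b n) T :=
  Commute.sum_left _ _ _ fun _ _ => ((hT _).sub_left (hT _)).smul_left _

/-- On the range of `E_l`, only the intervals starting below `l` contribute to the sum. -/
theorem dyadicSum_mul_le {E : ℝ → Projections R} (hE : Monotone E) {a b : ℝ}
    (hab : a ≤ b) (ha : (E a).1 = 0) (hb : (E b).1 = 1) (n : ℕ) (l : ℝ) :
    dyadicSum E a b n * (E l).1 ≤ l • (E l).1 := by
  conv_rhs => rw [← one_mul (E l).1, ← sum_dyadic_sub ha hb n]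
  rw [dyadicSum, Finset.sum_mul, Finset.sum_mul, Finset.smul_sum]
  refine Finset.sum_le_sum fun k _ => ?_
  have hk := dyadicPoint_mono hab n k
  rw [smul_mul_assoc]
  rcases le_total (dyadicPoint a b n k) l with h | h
  · exact smul_le_smul_of_nonneg_right h ((isStarProjection_sub_of_monotone hE hk).mul (E l).2.2
      (commute_sub_of_monotone hE _ _ _)).nonneg
  · rw [sub_mul, (mul_of_projections_le (hE h)).2, (mul_of_projections_le (hE (h.trans hk))).2,
      sub_self, smul_zero, smul_zero]

/-- On the range of `1 - E_l`, only the intervals ending above `l` contribute to the sum, and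
these start above `l` minus the mesh. -/
theorem le_dyadicSum_mul {E : ℝ → Projections R} (hE : Monotone E) {a b : ℝ}
    (hab : a ≤ b) (ha : (E a).1 = 0) (hb : (E b).1 = 1) (n : ℕ) (l : ℝ) :
    (l - (b - a) / 2 ^ n) • (1 - (E l).1) ≤ dyadicSum E a b n * (1 - (E l).1) := by
  have h1 : (1 - (E l).1) = (∑ k ∈ Finset.range (2 ^ n), ((E (dyadicPoint a b n (k + 1))).1 -
      (E (dyadicPoint a b n k)).1)) * (1 - (E l).1) := by rw [sum_dyadic_sub ha hb n, one_mul]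
  conv_lhs => rw [h1]
  rw [dyadicSum, Finset.sum_mul, Finset.sum_mul, Finset.smul_sum]
  refine Finset.sum_le_sum fun k _ => ?_
  have hk := dyadicPoint_mono hab n k
  rw [smul_mul_assoc]
  rcases le_total l (dyadicPoint a b n (k + 1)) with h | h
  · have h2 : l - (b - a) / 2 ^ n ≤ dyadicPoint a b n k := by
      rw [dyadicPoint_succ] at h
      linarith
    exact smul_le_smul_of_nonneg_right h2 ((isStarProjection_sub_of_monotone hE hk).mul
      (E l).2.2.one_sub ((Commute.one_right _).sub_right (commute_sub_of_monotone hE _ _ _))).nonneg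
  · rw [mul_sub, mul_one, sub_mul, (mul_of_projections_le (hE h)).1,
      (mul_of_projections_le (hE (hk.trans h))).1, sub_self, smul_zero, smul_zero]

/-! ### The operator with a given spectral family -/

theorem mem_of_forall_commute {A : H →L[ℂ] H} (h : ∀ T ∈ R.commutant, Commute A T) : A ∈ R := by
  rw [← commutant_commutant R, mem_commutant_iff]
  exact fun T hT => (h T hT).symm.eq

theorem commute_of_mem_commutant (P : Projections R) {T : H →L[ℂ] H} (hT : T ∈ R.commutant) :
    Commute P.1 T :=
  mem_commutant_iff.1 hT P.1 P.2.1

theorem commute_of_tendsto {A : ℕ → H →L[ℂ] H} {B T : H →L[ℂ] H}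
    (hA : Tendsto A atTop (𝓝 B)) (h : ∀ n, Commute (A n) T) : Commute B T :=
  tendsto_nhds_unique (hA.mul_const T) (by simpa only [(h _).eq] using hA.const_mul T)

/-- The integral of a spectral family: a selfadjoint element of `R` that lies below `l` on the
range of `E_l` and above `l` on its orthogonal complement. -/
theorem IsSpectralFamily.exists_integral {E : ℝ → Projections R} (hE : IsSpectralFamily E) :
    ∃ A : SelfAdjointPart R, ∀ l, Commute A.1 (E l).1 ∧ A.1 * (E l).1 ≤ l • (E l).1 ∧
      l • (1 - (E l).1) ≤ A.1 * (1 - (E l).1) := by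
  obtain ⟨a, ha⟩ := hE.exists_eq_zero
  obtain ⟨b, hab, hb⟩ : ∃ b, a ≤ b ∧ (E b).1 = 1 := by
    obtain ⟨b, hb⟩ := hE.exists_eq_one
    exact ⟨max a b, le_max_left _ _, coe_eq_one_iff.2
      (top_unique (coe_eq_one_iff.1 hb ▸ hE.mono (le_max_right a b)))⟩
  obtain ⟨A, hA⟩ := cauchySeq_tendsto_of_complete (cauchySeq_dyadicSum hE.mono hab ha hb)
  have hcomm : ∀ T, (∀ l, Commute (E l).1 T) → Commute A T := fun T hT =>
    commute_of_tendsto hA (commute_dyadicSum hT a b)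
  have hsa : IsSelfAdjoint A :=
    tendsto_nhds_unique (by simpa only [(isSelfAdjoint_dyadicSum E a b _).star_eq] using hA.star) hA
  refine ⟨⟨A, mem_of_forall_commute fun T hT => hcomm T fun l => commute_of_mem_commutant _ hT,
    hsa⟩, fun l => ⟨hcomm _ fun k => commute_of_monotone hE.mono k l, ?_, ?_⟩⟩
  · exact le_of_tendsto' (hA.mul_const _) fun n => dyadicSum_mul_le hE.mono hab ha hb n l
  · have hδ : Tendsto (fun n : ℕ => l - (b - a) / 2 ^ n) atTop (𝓝 l) := by
      have := (tendsto_pow_atTop_nhds_zero_of_lt_one (r := (1 / 2 : ℝ)) (by norm_num)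
        (by norm_num)).const_mul (b - a)
      simpa [div_eq_mul_inv] using this.const_sub l
    exact le_of_tendsto_of_tendsto' (hδ.smul_const _) (hA.mul_const _) fun n =>
      le_dyadicSum_mul hE.mono hab ha hb n l

/-- The positive part of `A - l` is determined by any decomposition of `A - l` as a difference of
nonnegative operators with product zero. -/
theorem posPartSub_eq {A B C : H →L[ℂ] H} (hA : IsSelfAdjoint A) {l : ℝ} (hB : 0 ≤ B)
    (hC : 0 ≤ C) (h : A - l • (1 : H →L[ℂ] H) = B - C) (hBC : B * C = 0) :
    posPartSub A l = B :=
  (CFC.posPart_negPart_unique (sub_eq_posPartSub_sub_negPartSub hA l)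
    (posPartSub_mul_negPartSub A l) (posPartSub_nonneg A l) (negPartSub_nonneg A l)).1.symm.trans
    (CFC.posPart_negPart_unique h hBC hB hC).1

/-- The two one-sided bounds of `A` by `l` pin down its spectral family. They say that
`(A - l)(1 - E_l)` is the positive part of `A - l`. A vector `y` in its kernel orthogonal to the
range of `E_l` satisfies `A y = l y`, so for `m > l` it has no component orthogonal to the range
of `E_m`, where `A ≥ m`; right continuity then puts `y` into the range of `E_l`. -/
theorem IsSpectralFamily.spectralFamily_eq {E : ℝ → Projections R} (hE : IsSpectralFamily E)
    {A : SelfAdjointPart R} (hA : ∀ l, Commute A.1 (E l).1 ∧ A.1 * (E l).1 ≤ l • (E l).1 ∧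
      l • (1 - (E l).1) ≤ A.1 * (1 - (E l).1)) : spectralFamily A = E := by
  funext l
  have hpos : posPartSub A.1 l = A.1 * (1 - (E l).1) - l • (1 - (E l).1) := by
    refine posPartSub_eq (C := l • (E l).1 - A.1 * (E l).1) A.2.2 (sub_nonneg.2 (hA l).2.2)
      (sub_nonneg.2 (hA l).2.1) ?_ ?_
    · rw [mul_sub, mul_one, smul_sub]
      abel
    · have h1 : l • (1 - (E l).1) = (l • 1) * (1 - (E l).1) := by rw [smul_mul_assoc, one_mul]
      have h2 : l • (E l).1 - A.1 * (E l).1 = (E l).1 * (l • 1 - A.1) := by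
        rw [mul_sub, (hA l).1.eq, mul_smul_comm, mul_one]
      rw [h1, h2, ← sub_mul, mul_assoc, ← mul_assoc (1 - (E l).1),
        (E l).2.2.one_sub_mul_self, zero_mul, mul_zero]
  -- Eigenvectors of `A` for the eigenvalue `l` lie in the range of `E_l`.
  have key : ∀ y : H, A.1 y = l • y → (E l).1 y = y := fun y hy => by
    rw [← mem_range_iff (E l).2.2, ← hE.right_continuous l]
    simp only [mem_range_iInf]
    intro m hm
    rw [mem_range_iff (E m).2.2]
    have hD := (E m).2.2.one_sub
    set D := 1 - (E m).1 with hDdef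
    have hADy : (A.1 * D) y = l • D y := by
      have hc : Commute A.1 D := (Commute.one_right _).sub_right (hA m).1
      rw [hc.eq, mul_apply_eq_comp, hy]
      exact D.map_smul_of_tower l y
    have h0 : 0 ≤ A.1 * D - m • D := sub_nonneg.2 (hA m).2.2
    have h1 := (ContinuousLinearMap.nonneg_iff_isPositive _).1 h0 |>.re_inner_nonneg_left y
    have h2 : (A.1 * D - m • D) y = (l - m) • D y := by
      rw [sub_apply, hADy, sub_smul]
      rfl
    have h3 : inner ℂ (D y) y = inner ℂ (D y) (D y) := by
      have hs : D.adjoint = D := hD.isSelfAdjoint.star_eq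
      conv_rhs => rw [← ContinuousLinearMap.adjoint_inner_left, hs, ← mul_apply_eq_comp,
        hD.isIdempotentElem.eq]
    rw [h2, inner_smul_left_eq_smul, h3, RCLike.smul_re, inner_self_eq_norm_sq] at h1
    have h4 : ‖D y‖ ^ 2 ≤ 0 := by
      by_contra h
      nlinarith [mul_pos (sub_pos.2 hm) (not_le.1 h)]
    have h5 : D y = 0 := norm_eq_zero.1
      (pow_eq_zero_iff two_ne_zero |>.1 (h4.antisymm (by positivity)))
    exact (sub_eq_zero.1 h5).symm
  refine le_antisymm ?_ ?_
  · rw [projections_le_iff, range_spectralFamily]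
    intro x hx
    have hx' : posPartSub A.1 l x = 0 := hx
    rw [hpos] at hx'
    have h1 := key ((1 - (E l).1) x) (sub_eq_zero.1 hx')
    have h2 : (E l).1 ((1 - (E l).1) x) = 0 := congr($((E l).2.2.mul_one_sub_self) x)
    rw [mem_range_iff (E l).2.2]
    exact (sub_eq_zero.1 (h1.symm.trans h2)).symm
  · rw [projections_le_iff, range_spectralFamily]
    intro x hx
    have hx' : (1 - (E l).1) x = 0 := sub_eq_zero.2 ((mem_range_iff (E l).2.2).1 hx).symm
    change posPartSub A.1 l x = 0
    rw [hpos]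
    change A.1 ((1 - (E l).1) x) - l • (1 - (E l).1) x = 0
    rw [hx', map_zero, smul_zero, sub_zero]

theorem IsSpectralFamily.exists_spectralFamily_eq {E : ℝ → Projections R}
    (hE : IsSpectralFamily E) : ∃ A : SelfAdjointPart R, spectralFamily A = E :=
  hE.exists_integral.imp fun _ hA => hE.spectralFamily_eq hA

end SpectralTheorem

end VonNeumannAlgebra

namespace VonNeumannAlgebra

section SpectralOrder

variable {H : Type*} [NormedAddCommGroup H] [InnerProductSpace ℂ H] [CompleteSpace H]
  {R : VonNeumannAlgebra H}

/-! ### Operator bounds read off from the spectral family -/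

theorem spectralFamily_eq_bot {A : SelfAdjointPart R} {l : ℝ} (hl : l < -‖A.1‖) :
    spectralFamily A l = ⊥ :=
  coe_eq_zero_iff.1 (spectralProjection_eq_zero A.2.2 hl)

theorem spectralFamily_eq_top {A : SelfAdjointPart R} {l : ℝ} (hl : ‖A.1‖ ≤ l) :
    spectralFamily A l = ⊤ :=
  coe_eq_one_iff.1 (spectralProjection_eq_one A.2.2 hl)

theorem posPartSub_eq_zero_of_le {A : H →L[ℂ] H} (hA : IsSelfAdjoint A) {c l : ℝ}
    (h : A ≤ c • (1 : H →L[ℂ] H)) (hcl : c ≤ l) : posPartSub A l = 0 := by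
  rw [← Algebra.algebraMap_eq_smul_one] at h
  rw [posPartSub, ← cfc_zero ℝ A]
  refine cfc_congr fun t ht => max_eq_right ?_
  linarith [(le_algebraMap_iff_spectrum_le (R := ℝ)).1 h t ht]

/-- An upper bound by a scalar in the usual order of operators is visible in the spectral
family. -/
theorem le_smul_one_iff (A : SelfAdjointPart R) (c : ℝ) :
    A.1 ≤ c • (1 : H →L[ℂ] H) ↔ ∀ l, c ≤ l → spectralFamily A l = ⊤ := by
  refine ⟨fun h l hl => coe_eq_one_iff.1 ?_, fun h => ?_⟩
  · have := spectralProjection_mul_of_posPartSub_mul (A := A.1) (T := 1) (l := l)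
      (by rw [posPartSub_eq_zero_of_le A.2.2 h hl, zero_mul])
    rwa [mul_one] at this
  · have h1 : spectralProjection A.1 c = 1 := coe_eq_one_iff.2 (h c le_rfl)
    have h2 := sub_mul_spectralProjection A.2.2 c
    rw [h1, mul_one] at h2
    rw [← sub_nonpos, h2]
    exact neg_nonpos.2 (negPartSub_nonneg A.1 c)

/-- A lower bound by a scalar in the usual order of operators is visible in the spectral
family. -/
theorem smul_one_le_iff (A : SelfAdjointPart R) (c : ℝ) :
    c • (1 : H →L[ℂ] H) ≤ A.1 ↔ ∀ l < c, spectralFamily A l = ⊥ := by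
  refine ⟨fun h l hl => coe_eq_zero_iff.1 ?_, fun h => ?_⟩
  · have hP := isStarProjection_spectralProjection A.1 l
    refine eq_zero_of_smul_nonpos hP (sub_pos.2 hl) ?_
    -- On the range of `E_l` the operator `A` is at least `c` and at most `l`.
    have h1 : A.1 * spectralProjection A.1 l ≤ l • spectralProjection A.1 l := by
      have h := sub_mul_spectralProjection A.2.2 l
      rw [sub_mul, smul_mul_assoc, one_mul] at h
      rw [← sub_nonpos, h]
      exact neg_nonpos.2 (negPartSub_nonneg A.1 l)
    have h2 := hP.isSelfAdjoint.conjugate_le_conjugate h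
    rw [mul_assoc _ A.1, (commute_spectralProjection A.2.2 l).eq, ← mul_assoc,
      hP.isIdempotentElem.eq, mul_smul_comm, smul_mul_assoc, mul_one, hP.isIdempotentElem.eq,
      ← (commute_spectralProjection A.2.2 l).eq] at h2
    rw [sub_smul]
    exact sub_nonpos.2 (h2.trans h1)
  · have h1 : ∀ l < c, l • (1 : H →L[ℂ] H) ≤ A.1 := fun l hl => by
      have h1 : spectralProjection A.1 l = 0 := coe_eq_zero_iff.2 (h l hl)
      have h2 := spectralProjection_mul_negPartSub A.1 l
      rw [h1, zero_mul] at h2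
      rw [← sub_nonneg, sub_eq_posPartSub_sub_negPartSub A.2.2, ← h2, sub_zero]
      exact posPartSub_nonneg A.1 l
    have h2 : Filter.Tendsto (fun l : ℝ => l • (1 : H →L[ℂ] H)) (nhdsWithin c (Set.Iio c))
        (nhds (c • 1)) :=
      ((continuous_id.smul continuous_const).tendsto c).mono_left nhdsWithin_le_nhds
    exact le_of_tendsto h2 (Filter.eventually_of_mem self_mem_nhdsWithin h1)

theorem effect_iff (A : SelfAdjointPart R) : (0 ≤ A.1 ∧ A.1 ≤ 1) ↔
    (∀ l < 0, spectralFamily A l = ⊥) ∧ ∀ l, 1 ≤ l → spectralFamily A l = ⊤ := by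
  rw [← smul_one_le_iff, ← le_smul_one_iff, zero_smul, one_smul]

/-- The scalar operator `c • 1`. -/
noncomputable def scalar (R : VonNeumannAlgebra H) (c : ℝ) : SelfAdjointPart R :=
  ⟨c • 1, by
    rw [← Complex.coe_smul]
    exact R.toStarSubalgebra.smul_mem (one_mem R) _, (IsSelfAdjoint.all c).smul (.one _)⟩

theorem spectralFamily_scalar_of_lt {c l : ℝ} (h : l < c) : spectralFamily (scalar R c) l = ⊥ :=
  (smul_one_le_iff _ c).1 le_rfl l h

theorem spectralFamily_scalar_of_le {c l : ℝ} (h : c ≤ l) : spectralFamily (scalar R c) l = ⊤ :=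
  (le_smul_one_iff _ c).1 le_rfl l h

/-- By `le_smul_one_iff`, the spectral order and the usual order of operators agree when the upper
element is a scalar; `scalar_le_iff` is the analogue for a lower scalar. -/
theorem le_scalar_iff (A : SelfAdjointPart R) (c : ℝ) :
    A ≤ scalar R c ↔ ∀ l, c ≤ l → spectralFamily A l = ⊤ := by
  refine ⟨fun h l hl => top_unique ((spectralFamily_scalar_of_le hl).ge.trans (h l)), fun h l => ?_⟩
  rcases lt_or_ge l c with hl | hl
  · rw [spectralFamily_scalar_of_lt hl]
    exact bot_le
  · rw [h l hl]
    exact le_top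

theorem scalar_le_iff (A : SelfAdjointPart R) (c : ℝ) :
    scalar R c ≤ A ↔ ∀ l < c, spectralFamily A l = ⊥ := by
  refine ⟨fun h l hl => bot_unique ((h l).trans_eq (spectralFamily_scalar_of_lt hl)), fun h l => ?_⟩
  rcases lt_or_ge l c with hl | hl
  · rw [h l hl]
    exact bot_le
  · rw [spectralFamily_scalar_of_le hl]
    exact le_top

/-- The effects are the order interval from `0` to `1` also for the spectral order. -/
theorem effect_iff_spectralOrder (A : SelfAdjointPart R) :
    (0 ≤ A.1 ∧ A.1 ≤ 1) ↔ scalar R 0 ≤ A ∧ A ≤ scalar R 1 := by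
  rw [effect_iff, scalar_le_iff, le_scalar_iff]

theorem le_scalar_norm (A : SelfAdjointPart R) {c : ℝ} (h : ‖A.1‖ ≤ c) : A ≤ scalar R c :=
  (le_scalar_iff A c).2 fun _ hl => spectralFamily_eq_top (h.trans hl)

theorem scalar_neg_norm_le (A : SelfAdjointPart R) {c : ℝ} (h : ‖A.1‖ ≤ c) :
    scalar R (-c) ≤ A :=
  (scalar_le_iff A _).2 fun _ hl => spectralFamily_eq_bot (hl.trans_le (neg_le_neg h))

/-! ### Suprema and infima for the spectral order -/

variable {K : Type*}

theorem isSpectralFamily_iInf [Nonempty K] {A : K → SelfAdjointPart R}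
    (hA : BddAbove (Set.range A)) :
    IsSpectralFamily fun l : ℝ => ⨅ k, spectralFamily (A k) l where
  mono _ _ h := iInf_mono fun k => spectralFamily_mono (A k) h
  right_continuous l := by
    rw [← iInf_congr fun k => spectralFamily_right_continuous (A k) l, iInf_comm]
    exact iInf_congr fun m => iInf_comm
  exists_eq_zero := by
    obtain ⟨k⟩ := ‹Nonempty K›
    refine ⟨-‖(A k).1‖ - 1, coe_eq_zero_iff.2 (bot_unique ((iInf_le _ k).trans_eq ?_))⟩
    exact spectralFamily_eq_bot (by linarith)
  exists_eq_one := by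
    obtain ⟨B, hB⟩ := hA
    refine ⟨‖B.1‖, coe_eq_one_iff.2 (top_unique (le_iInf fun k => ?_))⟩
    rw [← spectralFamily_eq_top (A := B) le_rfl]
    exact hB ⟨k, rfl⟩ _

theorem isSpectralFamily_iInf_iSup [Nonempty K] {A : K → SelfAdjointPart R}
    (hA : BddBelow (Set.range A)) :
    IsSpectralFamily fun l : ℝ => ⨅ m : ℝ, ⨅ _ : l < m, ⨆ k, spectralFamily (A k) m where
  mono _ _ h := le_iInf₂ fun m hm => iInf₂_le m (h.trans_lt hm)
  right_continuous l := by
    refine le_antisymm (le_iInf₂ fun m hm => ?_)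
      (le_iInf₂ fun m hm => le_iInf₂ fun m' hm' => iInf₂_le m' (hm.trans hm'))
    obtain ⟨m', h1, h2⟩ := exists_between hm
    exact (iInf₂_le m' h1).trans (iInf₂_le m h2)
  exists_eq_zero := by
    obtain ⟨B, hB⟩ := hA
    refine ⟨-‖B.1‖ - 2, coe_eq_zero_iff.2 (bot_unique ?_)⟩
    refine (iInf₂_le (-‖B.1‖ - 1) (by linarith)).trans (iSup_le fun k => ?_)
    rw [← spectralFamily_eq_bot (A := B) (l := -‖B.1‖ - 1) (by linarith)]
    exact hB ⟨k, rfl⟩ _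
  exists_eq_one := by
    obtain ⟨k⟩ := ‹Nonempty K›
    refine ⟨‖(A k).1‖, coe_eq_one_iff.2 (top_unique (le_iInf₂ fun m hm => ?_))⟩
    rw [← spectralFamily_eq_top (A := A k) hm.le]
    exact le_iSup (fun k => spectralFamily (A k) m) k

/-- The spectral order reverses the order of spectral families, so the supremum belongs to the
pointwise infimum of the spectral families. -/
theorem exists_isLUB_range [Nonempty K] {A : K → SelfAdjointPart R}
    (hA : BddAbove (Set.range A)) :
    ∃ S : SelfAdjointPart R, IsLUB (Set.range A) S ∧
      ∀ l, spectralFamily S l = ⨅ k, spectralFamily (A k) l := by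
  obtain ⟨S, hS⟩ := (isSpectralFamily_iInf hA).exists_spectralFamily_eq
  have hS := congrFun hS
  refine ⟨S, ⟨?_, fun B hB l => ?_⟩, hS⟩
  · rintro _ ⟨k, rfl⟩ l
    rw [hS]
    exact iInf_le _ k
  · rw [hS]
    exact le_iInf fun k => hB ⟨k, rfl⟩ l

/-- The pointwise supremum of spectral families need not be continuous from the right. Passing to
the infimum over `m > l` restores this, and it does not affect the order relations, since each
spectral family is itself continuous from the right. -/
theorem exists_isGLB_range [Nonempty K] {A : K → SelfAdjointPart R}
    (hA : BddBelow (Set.range A)) :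
    ∃ S : SelfAdjointPart R, IsGLB (Set.range A) S ∧
      ∀ l, spectralFamily S l = ⨅ m : ℝ, ⨅ _ : l < m, ⨆ k, spectralFamily (A k) m := by
  obtain ⟨S, hS⟩ := (isSpectralFamily_iInf_iSup hA).exists_spectralFamily_eq
  have hS := congrFun hS
  refine ⟨S, ⟨?_, fun B hB l => ?_⟩, hS⟩
  · rintro _ ⟨k, rfl⟩ l
    rw [hS]
    exact le_iInf₂ fun m hm => (spectralFamily_mono (A k) hm.le).trans
      (le_iSup (fun k => spectralFamily (A k) m) k)
  · rw [hS, ← spectralFamily_right_continuous B l]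
    exact iInf₂_mono fun m _ => iSup_le fun k => hB ⟨k, rfl⟩ m

theorem bddAbove_pair (A B : SelfAdjointPart R) : BddAbove {A, B} := by
  refine ⟨scalar R (max ‖A.1‖ ‖B.1‖), ?_⟩
  rintro _ (rfl | rfl)
  exacts [le_scalar_norm _ (le_max_left _ _), le_scalar_norm _ (le_max_right _ _)]

theorem bddBelow_pair (A B : SelfAdjointPart R) : BddBelow {A, B} := by
  refine ⟨scalar R (-max ‖A.1‖ ‖B.1‖), ?_⟩
  rintro _ (rfl | rfl)
  exacts [scalar_neg_norm_le _ (le_max_left _ _), scalar_neg_norm_le _ (le_max_right _ _)]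

theorem exists_effect_isLUB (A : K → EffectAlgebra R) :
    ∃ S : EffectAlgebra R, IsLUB (Set.range A) S ∧
      (Nonempty K → ∀ l, spectralFamily S.1 l = ⨅ k, spectralFamily (A k).1 l) := by
  have hA := fun B : EffectAlgebra R => (effect_iff_spectralOrder B.1).1 B.2
  rcases isEmpty_or_nonempty K with hK | hK
  · refine ⟨⟨scalar R 0, ?_⟩, ?_, fun h => (not_nonempty_iff.2 hK h).elim⟩
    · exact (effect_iff_spectralOrder _).2 ⟨le_rfl, (le_scalar_iff _ 1).2 fun l hl =>
        spectralFamily_scalar_of_le (zero_le_one.trans hl)⟩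
    · rw [Set.range_eq_empty, isLUB_empty_iff]
      exact fun B => (hA B).1
  · have hub : scalar R 1 ∈ upperBounds (Set.range fun k => (A k).1) := by
      rintro _ ⟨k, rfl⟩
      exact (hA (A k)).2
    obtain ⟨S, hS, hE⟩ := exists_isLUB_range ⟨_, hub⟩
    obtain ⟨k⟩ := id hK
    refine ⟨⟨S, (effect_iff_spectralOrder S).2
      ⟨(hA (A k)).1.trans (hS.1 ⟨k, rfl⟩), hS.2 hub⟩⟩, ⟨?_, fun B hB => hS.2 ?_⟩, fun _ => hE⟩
    · rintro _ ⟨k, rfl⟩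
      exact hS.1 ⟨k, rfl⟩
    · rintro _ ⟨k, rfl⟩
      exact hB ⟨k, rfl⟩

theorem exists_effect_isGLB (A : K → EffectAlgebra R) :
    ∃ S : EffectAlgebra R, IsGLB (Set.range A) S ∧
      (Nonempty K → ∀ l, spectralFamily S.1 l =
        ⨅ m : ℝ, ⨅ _ : l < m, ⨆ k, spectralFamily (A k).1 m) := by
  have hA := fun B : EffectAlgebra R => (effect_iff_spectralOrder B.1).1 B.2
  rcases isEmpty_or_nonempty K with hK | hK
  · refine ⟨⟨scalar R 1, ?_⟩, ?_, fun h => (not_nonempty_iff.2 hK h).elim⟩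
    · exact (effect_iff_spectralOrder _).2 ⟨(scalar_le_iff _ 0).2 fun l hl =>
        spectralFamily_scalar_of_lt (hl.trans zero_lt_one), le_rfl⟩
    · rw [Set.range_eq_empty, isGLB_empty_iff]
      exact fun B => (hA B).2
  · have hlb : scalar R 0 ∈ lowerBounds (Set.range fun k => (A k).1) := by
      rintro _ ⟨k, rfl⟩
      exact (hA (A k)).1
    obtain ⟨S, hS, hE⟩ := exists_isGLB_range ⟨_, hlb⟩
    obtain ⟨k⟩ := id hK
    refine ⟨⟨S, (effect_iff_spectralOrder S).2
      ⟨hS.2 hlb, (hS.1 ⟨k, rfl⟩).trans (hA (A k)).2⟩⟩, ⟨?_, fun B hB => hS.2 ?_⟩, fun _ => hE⟩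
    · rintro _ ⟨k, rfl⟩
      exact hS.1 ⟨k, rfl⟩
    · rintro _ ⟨k, rfl⟩
      exact hB ⟨k, rfl⟩

theorem range_cond_pair (A B : SelfAdjointPart R) :
    Set.range (fun b : Bool => cond b A B) = {A, B} := by
  rw [Bool.range_eq, Set.pair_comm]
  rfl

end SpectralOrder

end VonNeumannAlgebra

theorem mainTheorem2 {H : Type*} [NormedAddCommGroup H] [InnerProductSpace ℂ H] [CompleteSpace H]
    (R : VonNeumannAlgebra H) :
    (∀ A B : R.SelfAdjointPart,
      (∃ S : R.SelfAdjointPart, IsLUB {A, B} S) ∧ (∃ S : R.SelfAdjointPart, IsGLB {A, B} S)) ∧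
    (∀ (K : Type*) [Nonempty K] (A : K → R.SelfAdjointPart),
      (BddAbove (Set.range A) → ∃ S : R.SelfAdjointPart, IsLUB (Set.range A) S ∧
        ∀ l : ℝ, VonNeumannAlgebra.spectralFamily S l =
          ⨅ k, VonNeumannAlgebra.spectralFamily (A k) l) ∧
      (BddBelow (Set.range A) → ∃ S : R.SelfAdjointPart, IsGLB (Set.range A) S ∧
        ∀ l : ℝ, VonNeumannAlgebra.spectralFamily S l =
          ⨅ m : ℝ, ⨅ _ : l < m, ⨆ k, VonNeumannAlgebra.spectralFamily (A k) m)) ∧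
    (∀ (K : Type*) (A : K → R.EffectAlgebra),
      (∃ S : R.EffectAlgebra, IsLUB (Set.range A) S ∧
        (Nonempty K → ∀ l : ℝ, VonNeumannAlgebra.spectralFamily S.1 l =
          ⨅ k, VonNeumannAlgebra.spectralFamily (A k).1 l)) ∧
      (∃ S : R.EffectAlgebra, IsGLB (Set.range A) S ∧
        (Nonempty K → ∀ l : ℝ, VonNeumannAlgebra.spectralFamily S.1 l =
          ⨅ m : ℝ, ⨅ _ : l < m, ⨆ k, VonNeumannAlgebra.spectralFamily (A k).1 m))) := by
  refine ⟨fun A B => ⟨?_, ?_⟩, fun K _ A => ⟨VonNeumannAlgebra.exists_isLUB_range,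
    VonNeumannAlgebra.exists_isGLB_range⟩, fun K A =>
    ⟨VonNeumannAlgebra.exists_effect_isLUB A, VonNeumannAlgebra.exists_effect_isGLB A⟩⟩
  · have h := VonNeumannAlgebra.bddAbove_pair A B
    rw [← VonNeumannAlgebra.range_cond_pair] at h ⊢
    exact (VonNeumannAlgebra.exists_isLUB_range h).imp fun _ hS => hS.1
  · have h := VonNeumannAlgebra.bddBelow_pair A B
    rw [← VonNeumannAlgebra.range_cond_pair] at h ⊢
    exact (VonNeumannAlgebra.exists_isGLB_range h).imp fun _ hS => hS.1
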